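/- Let $\mathbb T$ be a commutative semiring with operations $\oplus,\odot$, zero $\mathbb 0$ and unit $\mathbb 1$, equipped with a symmetry $a\mapsto\ominus a$ (a map with $\ominus(a\oplus b)=(\ominus a)\oplus(\ominus b)$, $\ominus\mathbb 0=\mathbb 0$, $\ominus(ab)=(\ominus a)b=a(\ominus b)$ and $\ominus(\ominus a)=a$, possibly the identity). Assume that $\mathbb T$ is naturally ordered, i.e. the relation $a\preceq b\iff\exists c,\ b=a\oplus c$ is an order; that there is a modulus $|\cdot|:\mathbb T\to\mathbb M$, i.e. a surjective morphism of semirings onto a totally ordered idempotent semifield $\mathbb M$ (with its natural order); and that, with $a^\circ=a\oplus(\ominus a)$, for all $a,b\in\mathbb T$: 1. if $|a|\prec|b|$, then $a\oplus b=b$; 2. if $a\preceq b$, $|a|=|b|$, and $b$ is either invertible or equal to $\mathbb 0$, then $a=b$; 3. $a^\circ\oplus a^\circ=a^\circ$. Let $[n]=\{1,\dots,n\}$. For a bijection $\sigma:I\to J$ between totally ordered finite sets let $\operatorname{sign}(\sigma)=(\ominus\mathbb 1)^{\operatorname{inv}(\sigma)}\in\mathbb T$, where $\operatorname{inv}(\sigma)$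 is the number of pairs $i<j$ in $I$ with $\sigma(i)>\sigma(j)$. For $A=(a_{i,j})\in\mathbb T^{n\times n}$ and $k\in\{0,\dots,n\}$, the $k$-th compound matrix $A^{\wedge k}$ is indexed by the $k$-element subsets of $[n]$ and has the entries $$A^{\wedge k}_{I,J}=\bigoplus_{\sigma:I\to J\text{ bijective}}\operatorname{sign}(\sigma)\bigodot_{i\in I}a_{i,\sigma(i)} .$$ The matrix $A$ is nonsingular if $\det(A)=\bigoplus_{\sigma}\operatorname{sign}(\sigma)\bigodot_{i\in[n]}a_{i,\sigma(i)}$ (sum over all permutations $\sigma$ of $[n]$) is invertible in $\mathbb T$. The Kleene star $A^*$ is the supremum, for the entrywise order $\preceq$, of the partial sums $A^0\oplus A^1\oplus\cdots\oplus A^m$, $m\ge 0$, when this supremum exists. The modulus of a matrix is taken entrywise, and $I^c=[n]\setminus I$. **Corollary.** Let $A\in\mathbb T^{n\times n}$ be nonsingular, and assume that $A^*$ exists and $A=A^*$. Then $$|A^{\wedge n-k}|_{J^c,I^c}=|A^{\wedge k}|_{I,J}$$ for all $k\in\{0,\dots,n\}$ and all $k$-element subsets $I,J$ of $[n]$. 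-/

import Mathlib

namespace TropicalCompound

open Finset

/-- A symmetry `τ` (written `⊖`) of a commutative semiring: an additive involution (possibly the
identity) commuting with multiplication by scalars. -/
structure IsSymmetry {T : Type*} [CommSemiring T] (τ : T → T) : Prop where
  map_add : ∀ a b : T, τ (a + b) = τ a + τ b
  map_zero : τ 0 = 0
  map_mul_left : ∀ a b : T, τ (a * b) = τ a * b
  map_mul_right : ∀ a b : T, τ (a * b) = a * τ b
  involutive : ∀ a : T, τ (τ a) = a

/-- `a° = a ⊖ a`. -/
def circ {T : Type*} [CommSemiring T] (τ : T → T) (a : T) : T := a + τ a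

/-- `T` is an extended tropical semiring with symmetry `τ` and modulus `μ : T → M`.

The classes `[PartialOrder T] [CanonicallyOrderedAdd T]` say that `T` is naturally ordered, with `≤`
the natural order: `a ≤ b ↔ ∃ c, b = a + c`. The classes
`[Semifield M] [LinearOrder M] [CanonicallyOrderedAdd M]` together with the field `idem` say that
`M` is a totally ordered idempotent semifield, with `≤` its natural order. -/
structure IsExtendedTropical {T M : Type*} [CommSemiring T] [PartialOrder T]
    [CanonicallyOrderedAdd T] [Semifield M] [LinearOrder M] [CanonicallyOrderedAdd M]
    (τ : T → T) (μ : T →+* M) : Prop where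
  symmetry : IsSymmetry τ
  idem : ∀ x : M, x + x = x
  modulus_surjective : Function.Surjective μ
  add_eq_right_of_modulus_lt : ∀ a b : T, μ a < μ b → a + b = b
  eq_of_le_of_modulus_eq : ∀ a b : T, a ≤ b → μ a = μ b → (IsUnit b ∨ b = 0) → a = b
  circ_idem : ∀ a : T, circ τ a + circ τ a = circ τ a

/-- The number of inversions of a bijection between finite totally ordered sets. -/
def invCount {α β : Type*} [Fintype α] [LinearOrder α] [LinearOrder β] (σ : α ≃ β) : ℕ :=
  #{p : α × α | p.1 < p.2 ∧ σ p.2 < σ p.1}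

/-- The sign `(⊖1) ^ (number of inversions)` of a bijection, as an element of the semiring. -/
def bijSign {T : Type*} [CommSemiring T] (τ : T → T) {α β : Type*} [Fintype α] [LinearOrder α]
    [LinearOrder β] (σ : α ≃ β) : T :=
  τ 1 ^ invCount σ

/-- The determinant over a semiring with symmetry. -/
def tropDet {T : Type*} [CommSemiring T] (τ : T → T) {n : ℕ} (A : Matrix (Fin n) (Fin n) T) : T :=
  ∑ σ : Equiv.Perm (Fin n), bijSign τ σ * ∏ i, A i (σ i)

/-- A matrix is nonsingular if its determinant is invertible in the semiring. -/
def IsNonsingular {T : Type*} [CommSemiring T] (τ : T → T) {n : ℕ}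
    (A : Matrix (Fin n) (Fin n) T) : Prop :=
  IsUnit (tropDet τ A)

/-- The `k`-th compound matrix `A^{∧k}`, indexed by the `k`-subsets of `{1, …, n}`; its `(I, J)`
entry is the sum over all bijections `σ : I → J` of `sign σ * ∏ i ∈ I, A i (σ i)`. -/
def compound {T : Type*} [CommSemiring T] (τ : T → T) {n : ℕ} (A : Matrix (Fin n) (Fin n) T)
    (k : ℕ) : Matrix (Set.powersetCard (Fin n) k) (Set.powersetCard (Fin n) k) T :=
  fun I J => ∑ σ : (I : Finset (Fin n)) ≃ (J : Finset (Fin n)), bijSign τ σ *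
    ∏ i : (I : Finset (Fin n)), A i (σ i)

/-- The complement of a `k`-subset of `{1, …, n}`, as an `(n - k)`-subset. -/
def complSubset {n k : ℕ} (hk : k ≤ n) (I : Set.powersetCard (Fin n) k) :
    Set.powersetCard (Fin n) (n - k) :=
  Set.powersetCard.compl (by rw [Fintype.card_fin]; exact Nat.sub_add_cancel hk) I

/-- `S` is the Kleene star of `A`: the nondecreasing sequence of partial sums
`A^0 + A^1 + ⋯ + A^m` converges to `S`, i.e. has supremum `S` (entrywise, which for the entrywise
order on matrices is the same as the supremum in the set of matrices). In particular, `S` exists. -/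
def IsKleeneStar {T : Type*} [CommSemiring T] [PartialOrder T] {n : ℕ}
    (A S : Matrix (Fin n) (Fin n) T) : Prop :=
  ∀ i j, IsLUB (Set.range fun m : ℕ => (∑ l ∈ range (m + 1), A ^ l) i j) (S i j)

end TropicalCompound

/-!
The modulus sends every sign to `1`, because `(⊖1)² = 1` and a totally ordered idempotent semifield
has no other square root of `1`. Hence the modulus of a compound entry is the *permanent* of the
corresponding submatrix of `B = |A|`, and sums in the codomain are maxima. The hypothesis `A = A*`
becomes `1 ≤ B i i` and `B i j * B j l ≤ B i l`; consequently `B i i = 1`.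

A bijection `σ : I → J`, seen as a graph on `{1, …, n}`, splits into cycles and into paths from
`I \ J` to `J \ I`. Cycles have weight at most `1`, and the weight of a path is at most that of the
single arc joining its ends. Contracting the paths, and taking the identity outside `I ∪ J`, gives a
bijection `Jᶜ → Iᶜ` of weight at least that of `σ`. So the permanent of `B[I, J]` is at most that of
`B[Jᶜ, Iᶜ]`, and applying this to `Jᶜ, Iᶜ` gives equality. The contraction is carried out one arc at
a time in `exists_perm_prod_le`.
-/

namespace TropicalCompound

open Finset

/-! ### Order in canonically ordered semirings -/

lemma sum_le_of_forall_le_of_idem {M ι : Type*} [CommSemiring M] [PartialOrder M]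
    [CanonicallyOrderedAdd M] (idem : ∀ x : M, x + x = x) (s : Finset ι) (f : ι → M) (c : M)
    (h : ∀ i ∈ s, f i ≤ c) : ∑ i ∈ s, f i ≤ c :=
  Finset.sum_induction f (· ≤ c) (fun _ _ ha hb => (add_le_add ha hb).trans_eq (idem c))
    zero_le h

lemma eq_one_of_mul_self_eq_one {M : Type*} [CommSemiring M] [LinearOrder M]
    [CanonicallyOrderedAdd M] {x : M} (h : x * x = 1) : x = 1 := by
  rcases le_total x 1 with hx | hx
  · exact hx.antisymm (by simpa [h] using mul_le_mul_right hx x)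
  · exact le_antisymm (by simpa [h] using mul_le_mul_right hx x) hx

lemma le_one_of_mul_self_le {M : Type*} [Semifield M] [PartialOrder M] [CanonicallyOrderedAdd M]
    {x : M} (h : x * x ≤ x) : x ≤ 1 := by
  rcases eq_or_ne x 0 with rfl | hx
  · exact zero_le
  · simpa [mul_assoc, hx] using mul_le_mul_left h x⁻¹

/-! ### Contracting a partial bijection -/

/-- The weight of the partial bijection `π` restricted to `I` is at most the weight of
`π i ↦ θ i` on `Iᶜ`; as `θ` fixes `I`, the latter is a bijection from `(π '' I)ᶜ` to `Iᶜ`. -/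
lemma exists_perm_prod_le {M α : Type*} [CommSemiring M] [PartialOrder M] [CanonicallyOrderedAdd M]
    [Fintype α] [DecidableEq α] (B : Matrix α α M) (hdiag : ∀ i, B i i ≤ 1)
    (htrans : ∀ i j l, B i j * B j l ≤ B i l) (hrefl : ∀ i, 1 ≤ B i i)
    (π : Equiv.Perm α) (I : Finset α) :
    ∃ θ : Equiv.Perm α, (∀ i ∈ I, θ i = i) ∧
      ∏ i ∈ I, B i (π i) ≤ ∏ i ∈ Iᶜ, B (π i) (θ i) := by
  induction I using Finset.induction_on with
  | empty =>
    refine ⟨π, by simp, ?_⟩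
    simpa using Finset.prod_induction (fun i => B (π i) (π i)) (1 ≤ ·)
      (fun _ _ ha hb => one_le_mul ha hb) le_rfl (fun i _ => hrefl (π i))
  | insert a I ha ih =>
    obtain ⟨θ, hfix, hle⟩ := ih
    have hIc : Iᶜ = insert a (insert a I)ᶜ := by
      ext x; by_cases hx : x = a <;> simp [hx, ha]
    have hle' : ∏ i ∈ insert a I, B i (π i) ≤
        B a (π a) * (B (π a) (θ a) * ∏ i ∈ (insert a I)ᶜ, B (π i) (θ i)) := by
      rw [prod_insert ha]
      refine mul_le_mul_right (hle.trans_eq ?_) _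
      rw [hIc, prod_insert (by simp)]
    by_cases hθ : θ a = a
    · -- The new arc `a → π a` closes a cycle, which is dropped.
      refine ⟨θ, by simpa [hθ] using hfix, hle'.trans ?_⟩
      rw [hθ, ← mul_assoc]
      exact (mul_le_mul_left ((htrans _ _ _).trans (hdiag a)) _).trans_eq (one_mul _)
    · -- The new arc joins the path ending at `a = θ p` to the one from `π a` to `θ a`.
      obtain ⟨p, hp⟩ := θ.surjective a
      have hpa : p ≠ a := fun h => hθ (h ▸ hp)
      have hpI : p ∉ I := fun h => ha (by rw [← hp, hfix p h]; exact h)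
      have hmem : p ∈ (insert a I)ᶜ := by simp [hpa, hpI]
      refine ⟨Equiv.swap a (θ a) * θ, fun i hi => ?_, hle'.trans ?_⟩
      · rcases mem_insert.1 hi with rfl | hi
        · simp
        · have hia : i ≠ a := fun h => ha (h ▸ hi)
          have hiθ : i ≠ θ a := fun h => hia (θ.injective ((hfix i hi).trans h))
          simp [hfix i hi, Equiv.swap_apply_of_ne_of_ne hia hiθ]
      · rw [← mul_prod_erase _ _ hmem, ← mul_prod_erase _ _ hmem]
        have hrest : ∏ i ∈ (insert a I)ᶜ.erase p, B (π i) ((Equiv.swap a (θ a) * θ) i) =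
            ∏ i ∈ (insert a I)ᶜ.erase p, B (π i) (θ i) := by
          refine prod_congr rfl fun i hi => ?_
          simp only [mem_erase, mem_compl, mem_insert, not_or] at hi
          have h1 : θ i ≠ a := fun h => hi.1 (θ.injective (h.trans hp.symm))
          have h2 : θ i ≠ θ a := fun h => hi.2.1 (θ.injective h)
          simp [Equiv.swap_apply_of_ne_of_ne h1 h2]
        rw [hrest, Equiv.Perm.mul_apply, hp, Equiv.swap_apply_left]
        calc B a (π a) * (B (π a) (θ a) * (B (π p) a * _))
            = B (π p) a * B a (π a) * B (π a) (θ a) * _ := by ring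
          _ ≤ _ := mul_le_mul_left
            ((mul_le_mul_left (htrans _ _ _) _).trans (htrans _ _ _)) _

/-! ### Permanents of submatrices -/

/-- The permanent of the submatrix of `B` with rows `I` and columns `J`, as a sum over the
bijections `I → J`; it is `0` if there are none. -/
def subPermanent {M α : Type*} [CommSemiring M] [DecidableEq α] (B : Matrix α α M)
    (I J : Finset α) : M :=
  ∑ σ : I ≃ J, ∏ i : I, B i (σ i)

lemma subPermanent_le_compl {M α : Type*} [CommSemiring M] [PartialOrder M]
    [CanonicallyOrderedAdd M] [Fintype α] [DecidableEq α] (idem : ∀ x : M, x + x = x)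
    (B : Matrix α α M) (hdiag : ∀ i, B i i ≤ 1) (htrans : ∀ i j l, B i j * B j l ≤ B i l)
    (hrefl : ∀ i, 1 ≤ B i i) (I J : Finset α) :
    subPermanent B I J ≤ subPermanent B Jᶜ Iᶜ := by
  refine sum_le_of_forall_le_of_idem idem _ _ _ fun σ _ => ?_
  let π : Equiv.Perm α := Equiv.extendSubtype σ
  have hσ : ∀ i : I, π i = σ i := fun i => Equiv.extendSubtype_apply_of_mem σ i i.2
  have hπ : ∀ i, π i ∈ J ↔ i ∈ I := fun i =>
    ⟨fun h => by_contra fun hi => Equiv.extendSubtype_not_mem σ i hi h,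
      Equiv.extendSubtype_mem σ i⟩
  obtain ⟨θ, hfix, hle⟩ := exists_perm_prod_le B hdiag htrans hrefl π I
  have hθ : ∀ i, θ i ∈ I ↔ i ∈ I := fun i =>
    ⟨fun h => θ.injective (hfix _ h) ▸ h, fun h => (hfix i h).symm ▸ h⟩
  let ρ : (Jᶜ : Finset α) ≃ (Iᶜ : Finset α) :=
    Equiv.subtypeEquiv (π.symm.trans θ) fun j => by simp [hθ, ← hπ]
  have hρ : ∏ j : (Jᶜ : Finset α), B j (ρ j) = ∏ i ∈ Iᶜ, B (π i) (θ i) := by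
    calc ∏ j : (Jᶜ : Finset α), B j (ρ j) = ∏ j ∈ Jᶜ, B j (θ (π.symm j)) :=
          prod_coe_sort Jᶜ fun j => B j (θ (π.symm j))
      _ = _ := prod_equiv π.symm (fun j => by simp [← hπ]) (fun j _ => by simp)
  calc ∏ i : I, B i (σ i) = ∏ i : I, B i (π i) := prod_congr rfl fun i _ => by rw [hσ]
    _ = ∏ i ∈ I, B i (π i) := prod_coe_sort I fun i => B i (π i)
    _ ≤ ∏ j : (Jᶜ : Finset α), B j (ρ j) := hle.trans_eq hρ.symm
    _ ≤ _ := single_le_sum (f := fun ρ : (Jᶜ : Finset α) ≃ (Iᶜ : Finset α) =>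
        ∏ j : (Jᶜ : Finset α), B j (ρ j)) (fun _ _ => zero_le) (mem_univ ρ)

lemma subPermanent_compl {M α : Type*} [CommSemiring M] [PartialOrder M]
    [CanonicallyOrderedAdd M] [Fintype α] [DecidableEq α] (idem : ∀ x : M, x + x = x)
    (B : Matrix α α M) (hdiag : ∀ i, B i i ≤ 1) (htrans : ∀ i j l, B i j * B j l ≤ B i l)
    (hrefl : ∀ i, 1 ≤ B i i) (I J : Finset α) :
    subPermanent B Jᶜ Iᶜ = subPermanent B I J :=
  le_antisymm
    (by simpa using subPermanent_le_compl idem B hdiag htrans hrefl Jᶜ Iᶜ)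
    (subPermanent_le_compl idem B hdiag htrans hrefl I J)

/-! ### Modulus of compounds and of Kleene stars -/

lemma IsSymmetry.apply_one_mul_self {T : Type*} [CommSemiring T] {τ : T → T}
    (h : IsSymmetry τ) : τ 1 * τ 1 = 1 := by
  rw [← h.map_mul_left, one_mul, h.involutive]

lemma map_compound_apply {T M : Type*} [CommSemiring T] [CommSemiring M] [LinearOrder M]
    [CanonicallyOrderedAdd M] {τ : T → T} (hτ : IsSymmetry τ) (μ : T →+* M) {n : ℕ}
    (A : Matrix (Fin n) (Fin n) T) (k : ℕ) (I J : Set.powersetCard (Fin n) k) :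
    (compound τ A k).map μ I J = subPermanent (A.map μ) I J := by
  have hsign : μ (τ 1) = 1 := eq_one_of_mul_self_eq_one <| by
    rw [← map_mul, hτ.apply_one_mul_self, map_one]
  simp [compound, subPermanent, bijSign, hsign]

lemma IsKleeneStar.pow_apply_le {T : Type*} [CommSemiring T] [PartialOrder T]
    [CanonicallyOrderedAdd T] {n : ℕ} {A S : Matrix (Fin n) (Fin n) T} (h : IsKleeneStar A S)
    (m : ℕ) (i j : Fin n) : (A ^ m) i j ≤ S i j := by
  refine le_trans ?_ ((h i j).1 ⟨m, rfl⟩)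
  simp only [Matrix.sum_apply]
  exact single_le_sum (f := fun l => (A ^ l) i j) (fun _ _ => zero_le)
    (self_mem_range_succ m)

lemma IsKleeneStar.one_le_apply_self {T : Type*} [CommSemiring T] [PartialOrder T]
    [CanonicallyOrderedAdd T] {n : ℕ} {A S : Matrix (Fin n) (Fin n) T} (h : IsKleeneStar A S)
    (i : Fin n) : 1 ≤ S i i := by
  simpa using h.pow_apply_le 0 i i

lemma IsKleeneStar.mul_apply_le {T : Type*} [CommSemiring T] [PartialOrder T]
    [CanonicallyOrderedAdd T] {n : ℕ} {A S : Matrix (Fin n) (Fin n) T} (h : IsKleeneStar A S)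
    (i j l : Fin n) : A i j * A j l ≤ S i l := by
  refine le_trans ?_ (h.pow_apply_le 2 i l)
  rw [pow_two, Matrix.mul_apply]
  exact single_le_sum (f := fun j => A i j * A j l) (fun _ _ => zero_le) (mem_univ j)

lemma map_le_map_of_le {T M : Type*} [CommSemiring T] [PartialOrder T] [CanonicallyOrderedAdd T]
    [CommSemiring M] [PartialOrder M] [CanonicallyOrderedAdd M] (μ : T →+* M) {a b : T}
    (h : a ≤ b) : μ a ≤ μ b := by
  obtain ⟨c, rfl⟩ := exists_add_of_le h
  rw [map_add]
  exact le_self_add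

end TropicalCompound

theorem corollary3p5 {T M : Type*} [CommSemiring T] [PartialOrder T] [CanonicallyOrderedAdd T]
    [Semifield M] [LinearOrder M] [CanonicallyOrderedAdd M]
    (τ : T → T) (μ : T →+* M) (hT : TropicalCompound.IsExtendedTropical τ μ)
    (n : ℕ) (A : Matrix (Fin n) (Fin n) T)
    (hA : TropicalCompound.IsNonsingular τ A) (hstar : TropicalCompound.IsKleeneStar A A)
    (k : ℕ) (hk : k ≤ n) (I J : Set.powersetCard (Fin n) k) :
    (TropicalCompound.compound τ A (n - k)).map μ
        (TropicalCompound.complSubset hk J) (TropicalCompound.complSubset hk I) =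
      (TropicalCompound.compound τ A k).map μ I J := by
  have htrans : ∀ i j l, A.map μ i j * A.map μ j l ≤ A.map μ i l := fun i j l => by
    simpa using TropicalCompound.map_le_map_of_le μ (hstar.mul_apply_le i j l)
  have hrefl : ∀ i, 1 ≤ A.map μ i i := fun i => by
    simpa using TropicalCompound.map_le_map_of_le μ (hstar.one_le_apply_self i)
  have hdiag : ∀ i, A.map μ i i ≤ 1 := fun i =>
    TropicalCompound.le_one_of_mul_self_le (htrans i i i)
  rw [TropicalCompound.map_compound_apply hT.symmetry,
    TropicalCompound.map_compound_apply hT.symmetry]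
  exact TropicalCompound.subPermanent_compl hT.idem _ hdiag htrans hrefl I J
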